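/- Let $(X,d)$ be a Polish metric space with its Borel $\sigma$-algebra, and let $m=(m_x)_{x\in X}$ be a random walk on $X$: a family of probability measures on $X$ depending measurably on $x$, each with finite first moment. For probability measures $\mu,\mu'$ let $\mathcal T_1(\mu,\mu')=\inf_\xi\int d(x,y)\,d\xi(x,y)$, the infimum being over all couplings $\xi$ of $\mu$ and $\mu'$, and for $x\ne y$ let $\kappa(x,y)=1-\mathcal T_1(m_x,m_y)/d(x,y)$. Suppose that there is a real $\kappa>0$ such that $\kappa(x,y)\ge\kappa$ for all $x\neq y$ in $X$, and let $\nu$ be an invariant probability measure of $m$, that is, $\nu=\int m_x\,d\nu(x)$ (under these hypotheses it is unique). Put $$\sigma(x)=\Bigl(\tfrac12\iint d(y,z)^2\,dm_x(y)\,dm_x(z)\Bigr)^{1/2},\qquad \sigma=\|\sigma(\cdot)\|_{L^2(X,\nu)},$$ $$n_x=\frac{\sigma(x)^2}{\sup\{\mathrm{Var}_{m_x}f:\ f:X\to\mathbb R\ \text{1-Lipschitz}\}},\qquad n=\inf_x n_x,$$ where the infimum is over the points $x$ at which the quotient is meaningful, i.e. $0<\sigma(x)<\infty$ ($n=+\infty$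 if there are none, and then $\sigma^2/(nc)$ is read as $0$ for every real $c$). Suppose that $\sigma<\infty$. Then every 1-Lipschitz function $f:X\to\mathbb R$ satisfies $$\mathrm{Var}_\nu f\ \le\ \frac{\sigma^2}{n\kappa(2-\kappa)}\ \le\ \frac{\sigma^2}{n\kappa}\ <\ \infty .$$ In particular every Lipschitz function $f:X\to\mathbb R$ belongs to $L^2(X,\nu)$, and $\iint d(x,y)^2\,d\nu(x)\,d\nu(y)<\infty$. -/

import Mathlib

open MeasureTheory ProbabilityTheory
open scoped ENNReal NNReal

namespace CoarseRicci

variable {X : Type*} [MetricSpace X] [MeasurableSpace X]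

/-- A random walk on `X`: a measurable family `x ↦ m x` of probability measures, each of which has
finite first moment. -/
structure IsRandomWalk (m : Kernel X X) : Prop where
  isMarkovKernel : IsMarkovKernel m
  finite_first_moment : ∀ x, ∃ o : X, ∫⁻ y, edist o y ∂(m x) < ∞

/-- The set of couplings of `μ` and `ν`: measures on `X × X` projecting to `μ` and `ν`. -/
def couplings (μ ν : Measure X) : Set (Measure (X × X)) :=
  {ξ | ξ.map Prod.fst = μ ∧ ξ.map Prod.snd = ν}

/-- The `L¹` transportation distance. -/
noncomputable def transportDist (μ ν : Measure X) : ℝ≥0∞ :=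
  ⨅ ξ ∈ couplings μ ν, ∫⁻ p, edist p.1 p.2 ∂ξ

/-- The (coarse) Ricci curvature of the random walk `m` in the direction `(x, y)`; it is meant for
`x ≠ y`. For a random walk the transportation distance below is finite. -/
noncomputable def ricciCurvature (m : Kernel X X) (x y : X) : ℝ :=
  1 - (transportDist (m x) (m y)).toReal / dist x y

/-- Ricci curvature at least `κ`: the curvature in the direction of any two distinct points is at
least `κ`. -/
def RicciCurvatureGE (m : Kernel X X) (κ : ℝ) : Prop :=
  ∀ x y : X, x ≠ y → κ ≤ ricciCurvature m x y

/-- The spread `σ(x)` of the random walk at `x`. -/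
noncomputable def spread (m : Kernel X X) (x : X) : ℝ≥0∞ :=
  ((1 / 2) * ∫⁻ y, ∫⁻ z, edist y z ^ 2 ∂(m x) ∂(m x)) ^ (1 / 2 : ℝ)

/-- The average spread `σ = ‖σ(x)‖_{L²(X, ν)}`. -/
noncomputable def averageSpread (m : Kernel X X) (ν : Measure X) : ℝ≥0∞ :=
  eLpNorm (spread m) 2 ν

/-- The local dimension `n_x`: the squared spread at `x` divided by the supremum of the variances
under `m x` of the `1`-Lipschitz functions. If `0 < σ(x) < ∞`, then numerator and denominator are
both positive and finite; otherwise the quotient has the form `0 / 0` or `∞ / ∞`. -/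
noncomputable def localDim (m : Kernel X X) (x : X) : ℝ≥0∞ :=
  spread m x ^ 2 / ⨆ (f : X → ℝ) (_ : LipschitzWith 1 f), evariance f (m x)

/-- The dimension `n = inf_x n_x`, the infimum being over all points `x` at which the quotient
defining `n_x` makes sense, that is, `0 < σ(x) < ∞`. -/
noncomputable def dimension (m : Kernel X X) : ℝ≥0∞ :=
  ⨅ (x : X) (_ : 0 < spread m x) (_ : spread m x < ∞), localDim m x

end CoarseRicci

/-! Write `Mf(x) = ∫ f dm_x`. Invariance gives the law of total variance `Var_ν f = ∫ Var_{m_x} f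
dν(x) + Var_ν(Mf)` (`evariance_invariant`). For an `L`-Lipschitz `f` the first term is at most
`L²σ²/n` (`lintegral_evariance_le`), and curvature makes `Mf` `(1-κ)L`-Lipschitz
(`lipschitzWith_integral`). Iterating gives a geometric series with sum `1/(1-(1-κ)²) = 1/(κ(2-κ))`
and a remainder `Var_ν(M^t f)`. No moment of `ν` is known beforehand, so the remainder is first
shown to vanish for bounded `f`, by dominated convergence; truncation and Fatou's lemma then remove
boundedness. Square integrability follows from the variance bound. -/

namespace CoarseRicci

/-! ### Variance as a double integral, and the law of total variance -/

section Variance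

variable {Ω : Type*} [MeasurableSpace Ω] {μ : Measure Ω} [IsProbabilityMeasure μ]

lemma lintegral_sq_edist_const {f : Ω → ℝ} (hf : MemLp f 2 μ) (c : ℝ) :
    ∫⁻ y, edist c (f y) ^ 2 ∂μ = evariance f μ + edist c (μ[f]) ^ 2 := by
  have hg : MemLp (fun y => f y - c) 2 μ := hf.sub (memLp_const c)
  have e (x y : ℝ) : edist x y ^ 2 = ENNReal.ofReal ((y - x) ^ 2) := by
    rw [edist_comm, edist_dist, ← ENNReal.ofReal_pow dist_nonneg, Real.dist_eq, sq_abs]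
  have h := variance_eq_sub hg
  rw [variance_sub_const hf.1, integral_sub (hf.integrable one_le_two) (integrable_const c)] at h
  simp only [integral_const, probReal_univ, one_smul, Pi.pow_apply] at h
  simp_rw [e]
  rw [← ofReal_integral_eq_lintegral_ofReal hg.integrable_sq (ae_of_all _ fun _ => sq_nonneg _),
    ← ofReal_variance hf, ← ENNReal.ofReal_add (variance_nonneg _ _) (sq_nonneg _), h]
  congr 1
  ring

lemma lintegral_sq_edist_eq_two_mul_evariance {f : Ω → ℝ} (hf : MemLp f 2 μ) :
    ∫⁻ x, ∫⁻ y, edist (f x) (f y) ^ 2 ∂μ ∂μ = 2 * evariance f μ := by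
  simp_rw [lintegral_sq_edist_const hf]
  rw [lintegral_add_left measurable_const, two_mul]
  simp only [lintegral_const, measure_univ, mul_one]
  simp [evariance, edist_eq_enorm_sub]

lemma evariance_eq_half_lintegral {f : Ω → ℝ} (hf : MemLp f 2 μ) :
    evariance f μ = (1 / 2) * ∫⁻ x, ∫⁻ y, edist (f x) (f y) ^ 2 ∂μ ∂μ := by
  rw [lintegral_sq_edist_eq_two_mul_evariance hf, ← mul_assoc, one_div,
    ENNReal.inv_mul_cancel two_ne_zero ENNReal.ofNat_ne_top, one_mul]

lemma measurable_sq_edist_comp {f : Ω → ℝ} (hf : Measurable f) :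
    Measurable fun p : Ω × Ω => edist (f p.1) (f p.2) ^ 2 :=
  ((hf.comp measurable_fst).edist (hf.comp measurable_snd)).pow_const 2

lemma memLp_two_of_lintegral_sq_edist_lt_top {f : Ω → ℝ} (hf : Measurable f)
    (h : ∫⁻ x, ∫⁻ y, edist (f x) (f y) ^ 2 ∂μ ∂μ < ∞) : MemLp f 2 μ := by
  have hm : Measurable fun x => ∫⁻ y, edist (f x) (f y) ^ 2 ∂μ :=
    (measurable_sq_edist_comp hf).lintegral_prod_right'
  -- Freezing one point with finite inner integral puts `f - f x` in `L²`.
  obtain ⟨x, hx⟩ := (ae_lt_top hm h.ne).exists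
  have hg : MemLp (fun y => f y - f x) 2 μ := by
    refine ⟨(hf.sub_const _).aestronglyMeasurable, ?_⟩
    rw [eLpNorm_lt_top_iff_lintegral_rpow_enorm_lt_top two_ne_zero ENNReal.ofNat_ne_top]
    simpa [edist_comm (f x), edist_eq_enorm_sub] using hx
  have h' := hg.add (memLp_const (f x))
  rwa [show (fun y => f y - f x) + (fun _ => f x) = f by ext; simp] at h'

lemma evariance_le_half_lintegral {f : Ω → ℝ} (hf : Measurable f) :
    evariance f μ ≤ (1 / 2) * ∫⁻ x, ∫⁻ y, edist (f x) (f y) ^ 2 ∂μ ∂μ := by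
  rcases eq_or_ne (∫⁻ x, ∫⁻ y, edist (f x) (f y) ^ 2 ∂μ ∂μ) ∞ with h | h
  · simp [h, ENNReal.mul_top]
  · exact (evariance_eq_half_lintegral
      (memLp_two_of_lintegral_sq_edist_lt_top hf h.lt_top)).le

lemma memLp_of_abs_le {f : Ω → ℝ} (hf : Measurable f) {A : ℝ}
    (h : ∀ x, |f x| ≤ A) (p : ℝ≥0∞) : MemLp f p μ :=
  MemLp.of_bound hf.aestronglyMeasurable A (ae_of_all _ h)

lemma abs_integral_le {f : Ω → ℝ} {A : ℝ}
    (h : ∀ x, |f x| ≤ A) : |∫ x, f x ∂μ| ≤ A := by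
  simpa using norm_integral_le_of_norm_le_const (μ := μ) (f := f) (C := A) (ae_of_all _ h)

/-- Both functions have the same `ν`-mean `c`. Integrate `(f - c)²` against `ν.bind m = ν` and split
each inner integral into variance plus squared bias. -/
lemma evariance_invariant {m : Kernel Ω Ω} [IsMarkovKernel m] {ν : Measure Ω}
    [IsProbabilityMeasure ν] (hν : Kernel.Invariant m ν) {f : Ω → ℝ} (hf : Measurable f) {A : ℝ}
    (h : ∀ x, |f x| ≤ A) :
    evariance f ν = ∫⁻ x, evariance f (m x) ∂ν + evariance (fun x => ∫ y, f y ∂(m x)) ν := by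
  have hM : Measurable fun x => ∫ y, f y ∂(m x) :=
    (hf.stronglyMeasurable.integral_kernel (κ := m)).measurable
  have hint : ∫ x, ∫ y, f y ∂(m x) ∂ν = ∫ x, f x ∂ν := by
    have hi : Integrable f (ν.bind m) := by
      rw [hν.def]; exact (memLp_of_abs_le hf h 1).integrable le_rfl
    have hc := Kernel.integral_comp (κ := Kernel.const Unit ν) (η := m) (a := ()) (f := f)
    simp only [Kernel.comp_apply, Kernel.const_apply] at hc
    rw [← hc hi, hν.def]
  set c := ∫ x, f x ∂ν with hc
  have e (g : Ω → ℝ) (hg : ∫ x, g x ∂ν = c) : evariance g ν = ∫⁻ x, edist c (g x) ^ 2 ∂ν := by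
    simp_rw [evariance, hg, edist_comm c, edist_eq_enorm_sub]
  have hmeas : Measurable fun x => edist c (f x) ^ 2 := (measurable_const.edist hf).pow_const 2
  rw [e f rfl, e _ hint, ← lintegral_add_right _ ((measurable_const.edist hM).pow_const 2)]
  conv_lhs => rw [← hν.def]
  rw [Measure.lintegral_bind m.aemeasurable hmeas.aemeasurable]
  exact lintegral_congr fun x => lintegral_sq_edist_const (memLp_of_abs_le hf h 2) c

end Variance

/-! ### Spread, dimension and the local variance bound -/

variable {X : Type*} [MetricSpace X] [MeasurableSpace X]

lemma spread_sq (m : Kernel X X) (x : X) :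
    spread m x ^ 2 = (1 / 2) * ∫⁻ y, ∫⁻ z, edist y z ^ 2 ∂(m x) ∂(m x) := by
  rw [spread, ← ENNReal.rpow_natCast, ← ENNReal.rpow_mul]
  norm_num

lemma averageSpread_sq (m : Kernel X X) (ν : Measure X) :
    averageSpread m ν ^ 2 = ∫⁻ x, spread m x ^ 2 ∂ν := by
  simpa using! eLpNorm_nnreal_pow_eq_lintegral (f := spread m) (μ := ν) (p := 2) two_ne_zero

lemma averageSpread_eq_zero [Subsingleton X] (m : Kernel X X) (ν : Measure X) :
    averageSpread m ν = 0 := by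
  rw [← pow_eq_zero_iff two_ne_zero, averageSpread_sq]
  have (x y : X) : edist x y = 0 := by rw [Subsingleton.elim x y, edist_self]
  simp [spread_sq, this]

lemma le_one_of_ricciCurvatureGE [Nontrivial X] {m : Kernel X X} {κ : ℝ}
    (hcurv : RicciCurvatureGE m κ) : κ ≤ 1 := by
  obtain ⟨x, y, hxy⟩ := exists_pair_ne X
  refine (hcurv x y hxy).trans ?_
  rw [ricciCurvature]
  exact sub_le_self _ (by positivity)

lemma lintegral_sq_edist_lt_top {ν : Measure X} [IsProbabilityMeasure ν]
    (h : ∀ f : X → ℝ, LipschitzWith 1 f → MemLp f 2 ν) :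
    ∫⁻ x, ∫⁻ y, edist x y ^ 2 ∂ν ∂ν < ∞ := by
  obtain ⟨o⟩ : Nonempty X := ν.nonempty_of_neZero
  have ho := h _ (LipschitzWith.dist_right o)
  have hfin : ∫⁻ x, edist o x ^ 2 ∂ν < ∞ := by
    have := (eLpNorm_lt_top_iff_lintegral_rpow_enorm_lt_top two_ne_zero
      ENNReal.ofNat_ne_top).1 ho.2
    simpa [edist_dist, Real.enorm_eq_ofReal dist_nonneg] using this
  have hb (x y : X) : edist x y ^ 2 ≤ 2 * edist o x ^ 2 + 2 * edist o y ^ 2 := by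
    have ht : edist x y ≤ edist o x + edist o y := edist_triangle_left x y o
    rw [edist_nndist, edist_nndist, edist_nndist] at *
    norm_cast at *
    rw [← NNReal.coe_le_coe] at *
    push_cast at *
    nlinarith [sq_nonneg (dist o x - dist o y), dist_nonneg (x := x) (y := y),
      dist_nonneg (x := o) (y := x), dist_nonneg (x := o) (y := y)]
  calc ∫⁻ x, ∫⁻ y, edist x y ^ 2 ∂ν ∂ν
      ≤ ∫⁻ x, ∫⁻ y, 2 * edist o x ^ 2 + 2 * edist o y ^ 2 ∂ν ∂ν :=
        lintegral_mono fun x => lintegral_mono fun y => hb x y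
    _ = 2 * ∫⁻ x, edist o x ^ 2 ∂ν + 2 * ∫⁻ x, edist o x ^ 2 ∂ν := by
        simp_rw [lintegral_add_left measurable_const, lintegral_const, measure_univ, mul_one]
        rw [lintegral_add_right _ measurable_const, lintegral_const, measure_univ, mul_one,
          lintegral_const_mul' _ _ ENNReal.ofNat_ne_top]
    _ < ∞ := by finiteness

variable [OpensMeasurableSpace X]

lemma evariance_le_sq_mul_spread_sq {m : Kernel X X} [IsMarkovKernel m] {f : X → ℝ} {L : ℝ≥0}
    (hf : LipschitzWith L f) (x : X) : evariance f (m x) ≤ L ^ 2 * spread m x ^ 2 := by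
  refine (evariance_le_half_lintegral hf.continuous.measurable).trans ?_
  rw [spread_sq, mul_left_comm]
  gcongr
  simp_rw [← lintegral_const_mul' ((L : ℝ≥0∞) ^ 2) _ (ENNReal.pow_ne_top ENNReal.coe_ne_top)]
  exact lintegral_mono fun y => lintegral_mono fun z => by
    simpa [mul_pow] using pow_le_pow_left' (hf y z) 2

lemma edist_integral_le_transportDist {μ μ' : Measure X} [IsProbabilityMeasure μ]
    [IsProbabilityMeasure μ'] {f : X → ℝ} {L : ℝ≥0} (hf : LipschitzWith L f) {A : ℝ}
    (h : ∀ x, |f x| ≤ A) :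
    edist (∫ x, f x ∂μ) (∫ x, f x ∂μ') ≤ L * transportDist μ μ' := by
  have hfm := hf.continuous.measurable
  -- Moving `L` inside the infimum over couplings needs `L ≠ 0`.
  rcases eq_or_ne L 0 with rfl | hL
  · obtain ⟨o⟩ : Nonempty X := μ.nonempty_of_neZero
    have hc (x : X) : f x = f o := by simpa using hf x o
    simp [hc]
  have hL' : (L : ℝ≥0∞) ≠ 0 := by exact_mod_cast hL
  simp_rw [transportDist, ENNReal.mul_iInf_of_ne hL' ENNReal.coe_ne_top]
  refine le_iInf₂ fun ξ hξ => ?_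
  obtain ⟨rfl, rfl⟩ := hξ
  have : IsProbabilityMeasure ξ :=
    ⟨by simpa [Measure.map_apply measurable_fst .univ] using
      measure_univ (μ := ξ.map Prod.fst)⟩
  rw [integral_map measurable_fst.aemeasurable hfm.aestronglyMeasurable,
    integral_map measurable_snd.aemeasurable hfm.aestronglyMeasurable,
    ← lintegral_const_mul' _ _ ENNReal.coe_ne_top]
  refine (edist_integral_le_lintegral_edist
    ((memLp_of_abs_le (hfm.comp measurable_fst) (fun p => h p.1) 1).integrable le_rfl)
    ((memLp_of_abs_le (hfm.comp measurable_snd) (fun p => h p.2) 1).integrable le_rfl)).trans ?_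
  exact lintegral_mono fun p => hf p.1 p.2

lemma measurable_spread [SecondCountableTopology X] (m : Kernel X X) [IsMarkovKernel m] :
    Measurable (spread m) := by
  have h1 : Measurable fun p : X × X => ∫⁻ z, edist p.2 z ^ 2 ∂(m p.1) := by
    have h : Measurable fun q : (X × X) × X => edist q.1.2 q.2 ^ 2 := by fun_prop
    simpa using! h.lintegral_kernel_prod_right' (κ := m.comap Prod.fst measurable_fst)
  exact (h1.lintegral_kernel_prod_right' (κ := m)).const_mul _ |>.pow_const _

/-- A 1-Lipschitz map does not increase distances, hence not the spread. This keeps `σ²/n` finite.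
-/
lemma one_le_dimension (m : Kernel X X) [IsMarkovKernel m] : 1 ≤ dimension m := by
  refine le_iInf fun x => le_iInf fun h0 => le_iInf fun h1 => ?_
  have hS : ⨆ (f : X → ℝ) (_ : LipschitzWith 1 f), evariance f (m x) ≤ spread m x ^ 2 :=
    iSup₂_le fun f hf => by simpa using evariance_le_sq_mul_spread_sq hf x
  rw [localDim, ENNReal.le_div_iff_mul_le (.inr (pow_ne_zero 2 h0.ne'))
    (.inr (ENNReal.pow_ne_top h1.ne)), one_mul]
  exact hS

lemma evariance_le_div_dimension_of_lipschitzWith_one {m : Kernel X X} [IsMarkovKernel m]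
    {f : X → ℝ} (hf : LipschitzWith 1 f) {x : X} (hx : spread m x < ∞) :
    evariance f (m x) ≤ spread m x ^ 2 / dimension m := by
  -- Points of zero spread are left out of the infimum defining `dimension`.
  rcases eq_or_ne (spread m x) 0 with h0 | h0
  · simpa [h0] using evariance_le_sq_mul_spread_sq (m := m) hf x
  have hn : dimension m ≤ localDim m x := iInf₂_le_of_le x h0.bot_lt (iInf_le _ hx)
  rw [ENNReal.le_div_iff_mul_le (.inr (pow_ne_zero 2 h0)) (.inr (ENNReal.pow_ne_top hx.ne)),
    mul_comm]
  calc dimension m * evariance f (m x)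
      ≤ localDim m x * ⨆ (f : X → ℝ) (_ : LipschitzWith 1 f), evariance f (m x) := by
        gcongr; exact le_iSup₂ (f := fun f (_ : LipschitzWith 1 f) => evariance f (m x)) f hf
    _ ≤ spread m x ^ 2 := by rw [localDim]; exact ENNReal.mul_le_of_le_div le_rfl

lemma evariance_le_div_dimension {m : Kernel X X} [IsMarkovKernel m] {f : X → ℝ} {L : ℝ≥0}
    (hf : LipschitzWith L f) {x : X} (hx : spread m x < ∞) :
    evariance f (m x) ≤ L ^ 2 * (spread m x ^ 2 / dimension m) := by
  rcases eq_or_ne L 0 with rfl | hL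
  · simpa using evariance_le_sq_mul_spread_sq (m := m) hf x
  have hg : LipschitzWith 1 fun y => (L : ℝ)⁻¹ * f y := by
    simpa [hL, Function.comp_def, nnnorm_inv] using!
      (lipschitzWith_smul ((L : ℝ)⁻¹)).comp hf
  have hfg : f = fun y => (L : ℝ) * ((L : ℝ)⁻¹ * f y) := by
    ext y; rw [mul_inv_cancel_left₀ (by exact_mod_cast hL)]
  rw [hfg, evariance_mul, ENNReal.ofReal_pow L.coe_nonneg, ENNReal.ofReal_coe_nnreal]
  gcongr
  exact evariance_le_div_dimension_of_lipschitzWith_one hg hx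

lemma lintegral_evariance_le [SecondCountableTopology X] {m : Kernel X X} [IsMarkovKernel m]
    {ν : Measure X} (hσ : averageSpread m ν < ∞) {f : X → ℝ} {L : ℝ≥0} (hf : LipschitzWith L f) :
    ∫⁻ x, evariance f (m x) ∂ν ≤ L ^ 2 * (averageSpread m ν ^ 2 / dimension m) := by
  have hn : (dimension m)⁻¹ ≠ ∞ :=
    ENNReal.inv_ne_top.2 (one_pos.trans_le (one_le_dimension m)).ne'
  have hfin : ∀ᵐ x ∂ν, spread m x ^ 2 < ∞ := by
    refine ae_lt_top ((measurable_spread m).pow_const 2) ?_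
    rw [← averageSpread_sq]; exact ENNReal.pow_ne_top hσ.ne
  rw [averageSpread_sq, div_eq_mul_inv, ← lintegral_mul_const' _ _ hn,
    ← lintegral_const_mul' _ _ (ENNReal.pow_ne_top ENNReal.coe_ne_top)]
  refine lintegral_mono_ae ?_
  filter_upwards [hfin] with x hx
  exact evariance_le_div_dimension hf ((ENNReal.pow_lt_top_iff.1 hx).resolve_right two_ne_zero)

/-! ### Contraction of Lipschitz constants -/

/-- The product coupling has finite cost. Without this, `toReal` in `ricciCurvature` would turn an
infinite distance into `0`. -/
lemma transportDist_ne_top {m : Kernel X X} (hm : IsRandomWalk m) (x y : X) :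
    transportDist (m x) (m y) ≠ ∞ := by
  have := hm.isMarkovKernel
  obtain ⟨o, ho⟩ := hm.finite_first_moment x
  obtain ⟨o', ho'⟩ := hm.finite_first_moment y
  have hfst : ((m x).prod (m y)).map Prod.fst = m x := Measure.fst_prod
  have hsnd : ((m x).prod (m y)).map Prod.snd = m y := Measure.snd_prod
  refine ((iInf₂_le ((m x).prod (m y)) ⟨hfst, hsnd⟩).trans_lt ?_).ne
  have hd (a : X) : Measurable fun z => edist a z := by fun_prop
  calc ∫⁻ p, edist p.1 p.2 ∂((m x).prod (m y))
      ≤ ∫⁻ p, (edist o p.1 + edist o o') + edist o' p.2 ∂((m x).prod (m y)) := by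
        refine lintegral_mono fun p => (edist_triangle4 p.1 o o' p.2).trans_eq ?_
        rw [edist_comm p.1 o]
    _ = (∫⁻ z, edist o z ∂(m x) + edist o o') + ∫⁻ z, edist o' z ∂(m y) := by
        rw [lintegral_add_right _ (g := fun p : X × X => edist o' p.2)
            ((hd o').comp measurable_snd),
          lintegral_add_right _ measurable_const]
        congr 1
        · congr 1
          · rw [← lintegral_map (hd o) measurable_fst, hfst]
          · simp
        · rw [← lintegral_map (hd o') measurable_snd, hsnd]
    _ < ∞ := by simp [ho, ho', edist_lt_top]

lemma transportDist_le {m : Kernel X X} (hm : IsRandomWalk m) {κ : ℝ}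
    (hcurv : RicciCurvatureGE m κ) {q : ℝ≥0} (hq : (q : ℝ) = 1 - κ) {x y : X} (hxy : x ≠ y) :
    transportDist (m x) (m y) ≤ q * edist x y := by
  have h := hcurv x y hxy
  rw [ricciCurvature, le_sub_comm, ← hq, div_le_iff₀ (dist_pos.2 hxy)] at h
  rw [← ENNReal.ofReal_toReal (transportDist_ne_top hm x y), edist_dist,
    ← ENNReal.ofReal_coe_nnreal (p := q), ← ENNReal.ofReal_mul q.coe_nonneg]
  exact ENNReal.ofReal_le_ofReal h

lemma lipschitzWith_integral {m : Kernel X X} (hm : IsRandomWalk m) {κ : ℝ}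
    (hcurv : RicciCurvatureGE m κ) {q : ℝ≥0} (hq : (q : ℝ) = 1 - κ) {f : X → ℝ} {L : ℝ≥0}
    (hf : LipschitzWith L f) {A : ℝ} (h : ∀ x, |f x| ≤ A) :
    LipschitzWith (q * L) fun x => ∫ y, f y ∂(m x) := by
  have := hm.isMarkovKernel
  intro x y
  rcases eq_or_ne x y with rfl | hxy
  · simp
  refine (edist_integral_le_transportDist hf h).trans ?_
  rw [ENNReal.coe_mul, mul_comm (q : ℝ≥0∞), mul_assoc]
  gcongr
  exact transportDist_le hm hcurv hq hxy

/-! ### Iteration, vanishing remainder and truncation -/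

open Filter Topology

lemma div_mul_inv_ofReal (s n : ℝ≥0∞) {c : ℝ} (hc : 0 < c) :
    s / n * (ENNReal.ofReal c)⁻¹ = s / (n * ENNReal.ofReal c) := by
  rw [div_eq_mul_inv, div_eq_mul_inv, mul_assoc, ENNReal.mul_inv
    (.inr ENNReal.ofReal_ne_top) (.inr (ENNReal.ofReal_pos.2 hc).ne')]

/-- The cap `2A` supplies a constant dominating function, so no moment of `ν` is needed. -/
lemma tendsto_lintegral_min_edist [SecondCountableTopology X] (ν : Measure X)
    [IsProbabilityMeasure ν] {q : ℝ≥0} (hq : q < 1) (L A : ℝ≥0) :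
    Tendsto (fun t : ℕ => ∫⁻ p, min (((q ^ t * L : ℝ≥0) : ℝ≥0∞) * edist p.1 p.2) (2 * A) ^ 2
      ∂(ν.prod ν)) atTop (𝓝 0) := by
  have hlim (p : X × X) : Tendsto (fun t : ℕ =>
      min (((q ^ t * L : ℝ≥0) : ℝ≥0∞) * edist p.1 p.2) (2 * A) ^ 2) atTop (𝓝 0) := by
    have h1 : Tendsto (fun t : ℕ => ((q ^ t * L : ℝ≥0) : ℝ≥0∞)) atTop (𝓝 0) := by
      have := (tendsto_pow_atTop_nhds_zero_of_lt_one (zero_le (a := q)) hq).mul_const L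
      rw [zero_mul] at this
      exact ENNReal.tendsto_coe.2 this
    have h2 := ENNReal.Tendsto.mul_const h1 (.inr (edist_ne_top p.1 p.2))
    rw [zero_mul] at h2
    have h3 := (ENNReal.continuous_pow 2).tendsto _ |>.comp
      (h2.min (tendsto_const_nhds (x := 2 * (A : ℝ≥0∞))))
    simpa using! h3
  have := tendsto_lintegral_of_dominated_convergence (μ := ν.prod ν)
    (F := fun (t : ℕ) p => min (((q ^ t * L : ℝ≥0) : ℝ≥0∞) * edist p.1 p.2) (2 * A) ^ 2)
    (f := fun _ => 0) (fun _ => (2 * (A : ℝ≥0∞)) ^ 2)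
    (fun t => ((measurable_edist.const_mul _).min measurable_const).pow_const 2)
    (fun t => ae_of_all _ fun p => pow_le_pow_left' (min_le_right _ _) 2)
    (by
      simp only [lintegral_const, measure_univ, mul_one]
      exact ENNReal.pow_ne_top (ENNReal.mul_ne_top ENNReal.ofNat_ne_top ENNReal.coe_ne_top))
    (ae_of_all _ hlim)
  simpa using this

lemma evariance_le_lintegral_min_edist (ν : Measure X) [IsProbabilityMeasure ν]
    [SecondCountableTopology X] {f : X → ℝ} {L A : ℝ≥0} (hf : LipschitzWith L f)
    (h : ∀ x, |f x| ≤ A) :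
    evariance f ν ≤ ∫⁻ p, min ((L : ℝ≥0∞) * edist p.1 p.2) (2 * A) ^ 2 ∂(ν.prod ν) := by
  have hfm := hf.continuous.measurable
  calc evariance f ν ≤ (1 / 2) * ∫⁻ x, ∫⁻ y, edist (f x) (f y) ^ 2 ∂ν ∂ν :=
        evariance_le_half_lintegral hfm
    _ ≤ 1 * ∫⁻ x, ∫⁻ y, edist (f x) (f y) ^ 2 ∂ν ∂ν := by
        gcongr; simp
    _ = ∫⁻ p, edist (f p.1) (f p.2) ^ 2 ∂(ν.prod ν) := by
        rw [one_mul, lintegral_prod]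
        exact (measurable_sq_edist_comp hfm).aemeasurable
    _ ≤ _ := by
        refine lintegral_mono fun p => pow_le_pow_left' (le_min (hf p.1 p.2) ?_) 2
        have e : (2 * (A : ℝ≥0∞)) = ENNReal.ofReal (2 * A) := by
          rw [ENNReal.ofReal_mul zero_le_two]; simp
        rw [e, edist_dist, Real.dist_eq]
        exact ENNReal.ofReal_le_ofReal ((abs_sub _ _).trans (by linarith [h p.1, h p.2]))

section Contraction

variable [SecondCountableTopology X] {m : Kernel X X} (hm : IsRandomWalk m) {κ : ℝ}
  (hcurv : RicciCurvatureGE m κ) {ν : Measure X} [IsProbabilityMeasure ν]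
  (hν : Kernel.Invariant m ν) (hσ : averageSpread m ν < ∞)
include hm hcurv hν hσ

/-- `D` stands for the full geometric series in `q²`; its fixed-point equation lets each step of the
induction absorb one new term without partial sums. -/
lemma evariance_le_add_lintegral_min_edist {q : ℝ≥0} (hq : (q : ℝ) = 1 - κ) {D : ℝ≥0∞}
    (hD : 1 + q ^ 2 * D = D) {A : ℝ≥0} (t : ℕ) {L : ℝ≥0} {f : X → ℝ}
    (hf : LipschitzWith L f) (h : ∀ x, |f x| ≤ A) :
    evariance f ν ≤ L ^ 2 * (averageSpread m ν ^ 2 / dimension m) * D +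
      ∫⁻ p, min (((q ^ t * L : ℝ≥0) : ℝ≥0∞) * edist p.1 p.2) (2 * A) ^ 2 ∂(ν.prod ν) := by
  have := hm.isMarkovKernel
  induction t generalizing L f with
  | zero => simpa using le_add_left (evariance_le_lintegral_min_edist ν hf h)
  | succ t ih =>
    rw [evariance_invariant hν hf.continuous.measurable h]
    refine (add_le_add (lintegral_evariance_le hσ hf)
      (ih (lipschitzWith_integral hm hcurv hq hf h) fun x => abs_integral_le h)).trans_eq ?_
    rw [← add_assoc, pow_succ q t, mul_assoc (q ^ t)]
    congr 1
    conv_rhs => rw [← hD]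
    push_cast
    ring

lemma evariance_le_of_bounded (hκ : 0 < κ) (hκ1 : κ ≤ 1) {f : X → ℝ} (hf : LipschitzWith 1 f)
    {A : ℝ≥0} (h : ∀ x, |f x| ≤ A) :
    evariance f ν ≤ averageSpread m ν ^ 2 / dimension m * (ENNReal.ofReal (κ * (2 - κ)))⁻¹ := by
  lift 1 - κ to ℝ≥0 using by linarith with q hq
  have hc : 0 < κ * (2 - κ) := mul_pos hκ (by linarith)
  -- This is `q² = 1 - κ(2 - κ)`.
  have hD : 1 + (q : ℝ≥0∞) ^ 2 * (ENNReal.ofReal (κ * (2 - κ)))⁻¹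
      = (ENNReal.ofReal (κ * (2 - κ)))⁻¹ := by
    rw [← ENNReal.ofReal_inv_of_pos hc, ← ENNReal.ofReal_coe_nnreal (p := q), hq,
      ← ENNReal.ofReal_pow (by linarith), ← ENNReal.ofReal_mul (by positivity),
      ← ENNReal.ofReal_one, ← ENNReal.ofReal_add zero_le_one (by positivity)]
    congr 1
    have : 2 - κ ≠ 0 := by linarith
    field_simp
    ring
  have hq1 : q < 1 := by rw [← NNReal.coe_lt_coe, hq]; simpa using hκ
  have hlim := (tendsto_lintegral_min_edist ν hq1 1 A).const_add
    (((1 : ℝ≥0) : ℝ≥0∞) ^ 2 * (averageSpread m ν ^ 2 / dimension m) *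
      (ENNReal.ofReal (κ * (2 - κ)))⁻¹)
  have := ge_of_tendsto' hlim fun t =>
    evariance_le_add_lintegral_min_edist hm hcurv hν hσ hq hD t hf h
  simpa using this

/-- Fatou is applied to squared differences on `X × X`, which converge pointwise under truncation
with no need to control the means. -/
lemma evariance_le_of_lipschitzWith_one (hκ : 0 < κ) (hκ1 : κ ≤ 1) {f : X → ℝ}
    (hf : LipschitzWith 1 f) :
    evariance f ν ≤ averageSpread m ν ^ 2 / dimension m * (ENNReal.ofReal (κ * (2 - κ)))⁻¹ := by
  set B := averageSpread m ν ^ 2 / dimension m * (ENNReal.ofReal (κ * (2 - κ)))⁻¹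
  let g (k : ℕ) (x : X) : ℝ := max (-k) (min k (f x))
  have hg (k : ℕ) : LipschitzWith 1 (g k) := (hf.const_min _).const_max _
  have hgA (k : ℕ) (x : X) : |g k x| ≤ (k : ℝ≥0) := by
    exact abs_le.2 ⟨by simp [g], by simp [g]⟩
  have hglim (x : X) : ∀ᶠ k : ℕ in atTop, g k x = f x := by
    obtain ⟨N, hN⟩ := exists_nat_ge |f x|
    filter_upwards [eventually_ge_atTop N] with k hk
    have := abs_le.1 (hN.trans (Nat.cast_le.2 hk))
    simp only [g]
    rw [min_eq_right this.2, max_eq_right this.1]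
  have hdbl (k : ℕ) : ∫⁻ p, edist (g k p.1) (g k p.2) ^ 2 ∂(ν.prod ν) ≤ 2 * B := by
    have hgm := (hg k).continuous.measurable
    rw [lintegral_prod _ (measurable_sq_edist_comp hgm).aemeasurable,
      lintegral_sq_edist_eq_two_mul_evariance (memLp_of_abs_le hgm (hgA k) 2)]
    gcongr
    exact evariance_le_of_bounded hm hcurv hν hσ hκ hκ1 (hg k) (hgA k)
  have hfm := hf.continuous.measurable
  have hfatou : ∫⁻ p, edist (f p.1) (f p.2) ^ 2 ∂(ν.prod ν) ≤ 2 * B := by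
    calc ∫⁻ p, edist (f p.1) (f p.2) ^ 2 ∂(ν.prod ν)
        = ∫⁻ p, liminf (fun k => edist (g k p.1) (g k p.2) ^ 2) atTop ∂(ν.prod ν) := by
          refine lintegral_congr fun p => ?_
          refine (Tendsto.liminf_eq ?_).symm
          refine tendsto_const_nhds.congr' ?_
          filter_upwards [hglim p.1, hglim p.2] with k h1 h2
          rw [h1, h2]
      _ ≤ liminf (fun k => ∫⁻ p, edist (g k p.1) (g k p.2) ^ 2 ∂(ν.prod ν)) atTop :=
          lintegral_liminf_le fun k =>
            measurable_sq_edist_comp (hg k).continuous.measurable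
      _ ≤ 2 * B := liminf_le_of_le (by isBoundedDefault) fun b hb => by
          obtain ⟨k, hk⟩ := hb.exists
          exact hk.trans (hdbl k)
  rw [lintegral_prod _ (measurable_sq_edist_comp hfm).aemeasurable] at hfatou
  calc evariance f ν ≤ (1 / 2) * ∫⁻ x, ∫⁻ y, edist (f x) (f y) ^ 2 ∂ν ∂ν :=
        evariance_le_half_lintegral hfm
    _ ≤ (1 / 2) * (2 * B) := by gcongr
    _ = B := by
        rw [← mul_assoc, one_div, ENNReal.inv_mul_cancel two_ne_zero ENNReal.ofNat_ne_top, one_mul]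

end Contraction

lemma averageSpread_sq_div_lt_top {m : Kernel X X} [IsMarkovKernel m] {ν : Measure X}
    (hσ : averageSpread m ν < ∞) {c : ℝ} (hc : 0 < c) :
    averageSpread m ν ^ 2 / (dimension m * ENNReal.ofReal c) < ∞ :=
  ENNReal.div_lt_top (ENNReal.pow_ne_top hσ.ne)
    (mul_ne_zero (one_pos.trans_le (one_le_dimension m)).ne' (ENNReal.ofReal_pos.2 hc).ne')

lemma memLp_two_of_evariance_lt_top {ν : Measure X} [IsProbabilityMeasure ν]
    (h : ∀ f : X → ℝ, LipschitzWith 1 f → evariance f ν < ∞) {K : ℝ≥0} {f : X → ℝ}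
    (hf : LipschitzWith K f) : MemLp f 2 ν := by
  -- Scaling by `K + 1` rather than `K` covers `K = 0`.
  have hK : K + 1 ≠ 0 := by positivity
  have hg : LipschitzWith 1 fun y => ((K + 1 : ℝ≥0) : ℝ)⁻¹ * f y := by
    have := (lipschitzWith_smul (((K + 1 : ℝ≥0) : ℝ)⁻¹))
      |>.comp (hf.weaken (le_add_right le_rfl : K ≤ K + 1))
    rw [nnnorm_inv, NNReal.nnnorm_eq, inv_mul_cancel₀ hK] at this
    exact this
  have hg2 := (evariance_lt_top_iff_memLp hg.continuous.measurable.aestronglyMeasurable).1 (h _ hg)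
  have := hg2.const_mul ((K + 1 : ℝ≥0) : ℝ)
  simpa only [mul_inv_cancel_left₀ (NNReal.coe_ne_zero.2 hK)] using this

end CoarseRicci

theorem proposition31 {X : Type*} [MetricSpace X] [PolishSpace X] [MeasurableSpace X]
    [BorelSpace X] (m : Kernel X X) (hm : CoarseRicci.IsRandomWalk m)
    (κ : ℝ) (hκ : 0 < κ) (hcurv : CoarseRicci.RicciCurvatureGE m κ)
    (ν : Measure X) [IsProbabilityMeasure ν] (hν : Kernel.Invariant m ν)
    (hσ : CoarseRicci.averageSpread m ν < ∞) :
    (∀ f : X → ℝ, LipschitzWith 1 f →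
      evariance f ν ≤ CoarseRicci.averageSpread m ν ^ 2 /
        (CoarseRicci.dimension m * ENNReal.ofReal (κ * (2 - κ)))) ∧
    (CoarseRicci.averageSpread m ν ^ 2 /
        (CoarseRicci.dimension m * ENNReal.ofReal (κ * (2 - κ))) ≤
      CoarseRicci.averageSpread m ν ^ 2 / (CoarseRicci.dimension m * ENNReal.ofReal κ)) ∧
    CoarseRicci.averageSpread m ν ^ 2 /
        (CoarseRicci.dimension m * ENNReal.ofReal κ) < ∞ ∧
    (∀ (K : ℝ≥0) (f : X → ℝ), LipschitzWith K f → MemLp f 2 ν) ∧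
    ∫⁻ x, ∫⁻ y, edist x y ^ 2 ∂ν ∂ν < ∞ := by
  have := hm.isMarkovKernel
  have htop := CoarseRicci.averageSpread_sq_div_lt_top hσ hκ
  suffices h : (∀ f : X → ℝ, LipschitzWith 1 f →
      evariance f ν ≤ CoarseRicci.averageSpread m ν ^ 2 /
        (CoarseRicci.dimension m * ENNReal.ofReal (κ * (2 - κ)))) ∧
      (CoarseRicci.averageSpread m ν ^ 2 /
        (CoarseRicci.dimension m * ENNReal.ofReal (κ * (2 - κ))) ≤
      CoarseRicci.averageSpread m ν ^ 2 / (CoarseRicci.dimension m * ENNReal.ofReal κ)) by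
    have hL2 {K : ℝ≥0} {f : X → ℝ} (hf : LipschitzWith K f) : MemLp f 2 ν :=
      CoarseRicci.memLp_two_of_evariance_lt_top
        (fun g hg => ((h.1 g hg).trans h.2).trans_lt htop) hf
    exact ⟨h.1, h.2, htop, fun K f hf => hL2 hf,
      CoarseRicci.lintegral_sq_edist_lt_top fun f hf => hL2 hf⟩
  -- On a single point the curvature condition is vacuous and `κ` may be large, but the spread is
  -- zero. Two distinct points force `κ ≤ 1`.
  rcases subsingleton_or_nontrivial X with hX | hX
  · have hσ0 := CoarseRicci.averageSpread_eq_zero m ν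
    refine ⟨fun f _ => ?_, by simp [hσ0]⟩
    obtain ⟨o⟩ : Nonempty X := ν.nonempty_of_neZero
    have hf (x : X) : f x = f o := congrArg f (Subsingleton.elim _ _)
    simp [evariance, hf]
  · have hκ1 := CoarseRicci.le_one_of_ricciCurvatureGE hcurv
    have hc : 0 < κ * (2 - κ) := mul_pos hκ (by linarith)
    refine ⟨fun f hf => ?_, ?_⟩
    · rw [← CoarseRicci.div_mul_inv_ofReal _ _ hc]
      exact CoarseRicci.evariance_le_of_lipschitzWith_one hm hcurv hν hσ hκ hκ1 hf
    · gcongr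
      exact le_mul_of_one_le_right hκ.le (by linarith)
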